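/- Let $R$ be a commutative ring with $1\neq 0$, $C$ a (coassociative, counital) $R$-coalgebra with comultiplication $c\mapsto\sum c_1\otimes c_2$ and counit $\varepsilon$, and let $C^*=\mathrm{Hom}_R(C,R)$ carry the convolution product $(f\star g)(c)=\sum f(c_1)g(c_2)$ with unity $\varepsilon$. Let $A$ be an associative $R$-algebra, not necessarily with unity, and let $P=(A,C)$ be a measuring $R$-pairing, i.e. an $R$-linear multiplicative map $\kappa_P:A\to C^*$ is given; write $\langle a,c\rangle=\kappa_P(a)(c)$. Conventions. $\mathcal M^C$ (resp. ${}^C\mathcal M$) is the category of right (resp. left) $C$-comodules that are coassociative with injective structure map, with colinear maps. Every right comodule $M$ is a left $A$-module by $am=\sum m_{0}\langle a,m_{1}\rangle$, and every left comodule $M$ is a right $A$-module by $ma=\sum\langle a,m_{-1}\rangle m_{0}$; colinear maps become $A$-linear. In particular $C$ is a left $A$-module ${}_AC$ and a right $A$-module $C_A$, and likewise (taking $A=C^*$, $\kappa=\mathrm{id}$) a left and right $C^*$-module. For a left $A$-module $K$, a left $A$-module is $K$-generated if it is the image of an $A$-linear map from a direct sum $K^{(\Lambda)}$, and $K$-subgenerated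 if it is isomorphic to a submodule of a $K$-generated module; $\sigma[{}_AK]$ is the full subcategory of the category of unital left $A$-modules ($AN=N$) consisting of the $K$-subgenerated ones. For right modules, $\sigma[K_A]$ is defined analogously. The assertion $\mathcal M^C\simeq\sigma[{}_AC]=\sigma[{}_{C^*}C]$ means: the functor $\mathcal M^C\to{}$($A$-modules) above takes values in $\sigma[{}_AC]$ and is an isomorphism of categories onto it, and restriction of scalars along $\kappa_P$ sends $\sigma[{}_{C^*}C]$ into $\sigma[{}_AC]$ and is an isomorphism of categories between them. The assertion ${}^C\mathcal M\simeq\sigma[C_A]=\sigma[C_{C^*}]$ is understood in the same way. **Theorem.** The following are equivalent: 1. $P$ satisfies the $\alpha$-condition: for every $R$-module $M$ the map $M\otimes_RC\to\mathrm{Hom}_R(A,M)$, $\sum m_i\otimes c_i\mapsto[a\mapsto\sum m_i\langle a,c_i\rangle]$, is injective; 2. $\mathcal M^C\simeq\sigma[{}_AC]=\sigma[{}_{C^*}C]$; 3. $C$ is locally projective over $R$ (for every surjective $R$-linear $g:L\to N$, every $R$-linear $f:C\to N$ and every finitely generated submodule $F\subseteq C$ there is an $R$-linear $h:C\to L$ with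 $g\circ h=f$ on $F$), and $\kappa_P(A)$ is dense in $C^*$ for the finite topology, i.e. the topology induced by $C^*\hookrightarrow R^C$ with the product topology, $R$ discrete; 4. ${}^C\mathcal M\simeq\sigma[C_A]=\sigma[C_{C^*}]$. -/

import Mathlib

open CategoryTheory
open scoped TensorProduct

universe u

namespace MeasuringPairing

section Categories

/-- A functor is an isomorphism of categories if it has a strict two-sided inverse. -/
def IsCatIso {X Y : Type*} [Category* X] [Category* Y] (F : X ⥤ Y) : Prop :=
  ∃ G : Y ⥤ X, F ⋙ G = 𝟭 X ∧ G ⋙ F = 𝟭 Y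

/-- `F` takes values in the full subcategory of `Y` cut out by `P`, and is, as a functor to
that full subcategory, an isomorphism of categories. -/
def IsIsoOntoFull {X Y : Type*} [Category* X] [Category* Y] (F : X ⥤ Y)
    (P : ObjectProperty Y) : Prop :=
  ∃ h : ∀ M : X, P (F.obj M), IsCatIso (P.lift F h)

end Categories

section Modules

/-- A left module over the `R`-algebra `A` (not necessarily with unity): an `R`-module `M` with
a multiplicative `R`-linear map `A → End_R M`.  No unitality is required at this stage.
Right `A`-modules are left modules over `Aᵐᵒᵖ`. -/
structure NUMod (R A : Type u) [CommRing R] [NonUnitalRing A] [Module R A] where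
  carrier : ModuleCat.{u} R
  act : A →ₙₐ[R] Module.End R carrier

variable {R A B : Type u} [CommRing R] [NonUnitalRing A] [Module R A]
  [NonUnitalRing B] [Module R B]

namespace NUMod

/-- `A`-linear maps. -/
@[ext]
structure Hom (M N : NUMod R A) where
  lin : M.carrier →ₗ[R] N.carrier
  map_act : ∀ (a : A) (m : M.carrier), lin (M.act a m) = N.act a (lin m)

instance : Category (NUMod R A) where
  Hom M N := Hom M N
  id M := ⟨LinearMap.id, fun _ _ => rfl⟩
  comp f g := ⟨g.lin ∘ₗ f.lin, fun a m => by
    simp only [LinearMap.comp_apply, f.map_act, g.map_act]⟩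

/-- The direct sum `K^(Λ)` of copies of `K`. -/
noncomputable def copower (Λ : Type u) (K : NUMod R A) : NUMod R A where
  carrier := ModuleCat.of R (Λ →₀ K.carrier)
  act :=
    { toFun := fun a => Finsupp.mapRange.linearMap (K.act a)
      map_smul' := fun r a => by
        refine LinearMap.ext fun x => Finsupp.ext fun l => ?_
        simp
      map_zero' := by
        refine LinearMap.ext fun x => Finsupp.ext fun l => ?_
        simp
      map_add' := fun a b => by
        refine LinearMap.ext fun x => Finsupp.ext fun l => ?_
        simp
      map_mul' := fun a b => by
        refine LinearMap.ext fun x => Finsupp.ext fun l => ?_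
        simp }

/-- `N` is `K`-generated: it is the image of an `A`-linear map from some `K^(Λ)`. -/
def IsGenerated (K N : NUMod R A) : Prop :=
  ∃ (Λ : Type u) (p : copower Λ K ⟶ N), Function.Surjective p.lin

/-- `N` is `K`-subgenerated: it is isomorphic to a submodule of a `K`-generated module. -/
def IsSubgenerated (K N : NUMod R A) : Prop :=
  ∃ (L : NUMod R A), IsGenerated K L ∧ ∃ i : N ⟶ L, Function.Injective i.lin

/-- `N` is unital: `A N = N`. -/
def IsUnital (N : NUMod R A) : Prop :=
  Submodule.span R {x : N.carrier | ∃ (a : A) (n : N.carrier), N.act a n = x} = ⊤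

/-- The objects of `σ[K]`: the `K`-subgenerated modules in the category of unital modules.
`σ[K]` is the full subcategory on these. -/
def sigma (K : NUMod R A) : ObjectProperty (NUMod R A) :=
  fun N => N.IsUnital ∧ IsSubgenerated K N

/-- Restriction of scalars along a morphism of `R`-algebras (not necessarily with unity). -/
def restrict (f : B →ₙₐ[R] A) : NUMod R A ⥤ NUMod R B where
  obj N := ⟨N.carrier, N.act.comp f⟩
  map g := ⟨g.lin, fun b m => g.map_act (f b) m⟩

end NUMod

/-- The morphism of opposite algebras given by a morphism of algebras. -/
def opHom (f : B →ₙₐ[R] A) : Bᵐᵒᵖ →ₙₐ[R] Aᵐᵒᵖ where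
  toFun b := MulOpposite.op (f b.unop)
  map_smul' r b := by simp
  map_zero' := by simp
  map_add' b c := by simp
  map_mul' b c := by simp

end Modules

section Comodules

variable (R C : Type u) [CommRing R] [AddCommGroup C] [Module R C] [Coalgebra R C]

/-- The dual algebra `C^*`, with the convolution product
`(f ⋆ g)(c) = ∑ f(c₁) g(c₂)` and unity `ε`. -/
abbrev DualAlg : Type u := WithConv (C →ₗ[R] R)

/-- Counital right `C`-comodules: coassociative with injective structure map. -/
structure RightComod where
  carrier : ModuleCat.{u} R
  coact : carrier →ₗ[R] carrier ⊗[R] C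
  coassoc : (TensorProduct.assoc R carrier C C).toLinearMap ∘ₗ coact.rTensor C ∘ₗ coact =
    (Coalgebra.comul (R := R) (A := C)).lTensor carrier ∘ₗ coact
  counital : Function.Injective coact

/-- Counital left `C`-comodules: coassociative with injective structure map. -/
structure LeftComod where
  carrier : ModuleCat.{u} R
  coact : carrier →ₗ[R] C ⊗[R] carrier
  coassoc : (TensorProduct.assoc R C C carrier).toLinearMap ∘ₗ
      (Coalgebra.comul (R := R) (A := C)).rTensor carrier ∘ₗ coact =
    coact.lTensor C ∘ₗ coact
  counital : Function.Injective coact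

variable {R C}

namespace RightComod

/-- `C`-colinear maps of right comodules. -/
@[ext]
structure Hom (M N : RightComod R C) where
  lin : M.carrier →ₗ[R] N.carrier
  colinear : N.coact ∘ₗ lin = lin.rTensor C ∘ₗ M.coact

instance : Category (RightComod R C) where
  Hom M N := Hom M N
  id M := ⟨LinearMap.id, by simp⟩
  comp f g := ⟨g.lin ∘ₗ f.lin, by
    rw [← LinearMap.comp_assoc, g.colinear, LinearMap.comp_assoc, f.colinear,
      LinearMap.rTensor_comp, LinearMap.comp_assoc]⟩

end RightComod

namespace LeftComod

/-- `C`-colinear maps of left comodules. -/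
@[ext]
structure Hom (M N : LeftComod R C) where
  lin : M.carrier →ₗ[R] N.carrier
  colinear : N.coact ∘ₗ lin = lin.lTensor C ∘ₗ M.coact

instance : Category (LeftComod R C) where
  Hom M N := Hom M N
  id M := ⟨LinearMap.id, by simp⟩
  comp f g := ⟨g.lin ∘ₗ f.lin, by
    rw [← LinearMap.comp_assoc, g.colinear, LinearMap.comp_assoc, f.colinear,
      LinearMap.lTensor_comp, LinearMap.comp_assoc]⟩

end LeftComod

variable (R C)

lemma comul_injective : Function.Injective (Coalgebra.comul (R := R) (A := C)) := by
  intro x y h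
  have hx := Coalgebra.rTensor_counit_comul (R := R) x
  have hy := Coalgebra.rTensor_counit_comul (R := R) y
  rw [h, hy] at hx
  simpa using congrArg (TensorProduct.lid R C) hx.symm

/-- `C` as a right comodule over itself. -/
def RightComod.self : RightComod R C where
  carrier := ModuleCat.of R C
  coact := Coalgebra.comul
  coassoc := Coalgebra.coassoc
  counital := comul_injective R C

/-- `C` as a left comodule over itself. -/
def LeftComod.self : LeftComod R C where
  carrier := ModuleCat.of R C
  coact := Coalgebra.comul
  coassoc := Coalgebra.coassoc
  counital := comul_injective R C

end Comodules

section Pairings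

variable {R A C : Type u} [CommRing R] [NonUnitalRing A] [Module R A]
  [AddCommGroup C] [Module R C] [Coalgebra R C]

/-- The endomorphism `m ↦ ∑ m₀ f(m₁)` of a right comodule. -/
noncomputable def rightEnd (M : RightComod R C) (f : C →ₗ[R] R) : Module.End R M.carrier :=
  (TensorProduct.rid R M.carrier).toLinearMap ∘ₗ f.lTensor M.carrier ∘ₗ M.coact

/-- The endomorphism `m ↦ ∑ f(m₋₁) m₀` of a left comodule. -/
noncomputable def leftEnd (M : LeftComod R C) (f : C →ₗ[R] R) : Module.End R M.carrier :=
  (TensorProduct.lid R M.carrier).toLinearMap ∘ₗ f.rTensor M.carrier ∘ₗ M.coact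

lemma rightEnd_mul (M : RightComod R C) (f g : DualAlg R C) :
    rightEnd M (f * g).ofConv = rightEnd M f.ofConv * rightEnd M g.ofConv := by
  have key : ∀ y : M.carrier ⊗[R] C,
      TensorProduct.rid R M.carrier ((LinearMap.mul' R R ∘ₗ
        TensorProduct.map f.ofConv g.ofConv).lTensor M.carrier
          (TensorProduct.assoc R M.carrier C C (M.coact.rTensor C y))) =
      rightEnd M f.ofConv (TensorProduct.rid R M.carrier (g.ofConv.lTensor M.carrier y)) := by
    intro y
    induction y with
    | zero => simp
    | add a b ha hb => simp only [map_add, ha, hb]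
    | tmul m c =>
      simp only [rightEnd, LinearMap.rTensor_tmul, LinearMap.lTensor_tmul,
        TensorProduct.rid_tmul, LinearMap.comp_apply, LinearEquiv.coe_coe, map_smul]
      generalize M.coact m = z
      induction z with
      | zero => simp
      | add a b ha hb => simp only [TensorProduct.add_tmul, map_add, ha, hb, smul_add]
      | tmul n d => simp [smul_smul, mul_comm]
  refine LinearMap.ext fun m => ?_
  have h := LinearMap.congr_fun M.coassoc m
  simp only [LinearMap.comp_apply, LinearEquiv.coe_coe] at h
  have k := key (M.coact m)
  rw [h, ← LinearMap.comp_apply (LinearMap.lTensor _ _), ← LinearMap.lTensor_comp] at k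
  exact k

lemma leftEnd_mul (M : LeftComod R C) (f g : DualAlg R C) :
    leftEnd M (f * g).ofConv = leftEnd M g.ofConv * leftEnd M f.ofConv := by
  have key : ∀ y : C ⊗[R] M.carrier,
      TensorProduct.lid R M.carrier ((LinearMap.mul' R R ∘ₗ
        TensorProduct.map f.ofConv g.ofConv).rTensor M.carrier
          ((TensorProduct.assoc R C C M.carrier).symm (M.coact.lTensor C y))) =
      leftEnd M g.ofConv (TensorProduct.lid R M.carrier (f.ofConv.rTensor M.carrier y)) := by
    intro y
    induction y with
    | zero => simp
    | add a b ha hb => simp only [map_add, ha, hb]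
    | tmul c m =>
      simp only [leftEnd, LinearMap.rTensor_tmul, LinearMap.lTensor_tmul,
        TensorProduct.lid_tmul, LinearMap.comp_apply, LinearEquiv.coe_coe, map_smul]
      generalize M.coact m = z
      induction z with
      | zero => simp
      | add a b ha hb => simp only [TensorProduct.tmul_add, map_add, ha, hb, smul_add]
      | tmul d n => simp [smul_smul]
  refine LinearMap.ext fun m => ?_
  have h := LinearMap.congr_fun M.coassoc m
  simp only [LinearMap.comp_apply, LinearEquiv.coe_coe] at h
  have k := key (M.coact m)
  rw [← h, LinearEquiv.symm_apply_apply, ← LinearMap.comp_apply (LinearMap.rTensor _ _),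
    ← LinearMap.rTensor_comp] at k
  exact k

/-- For a measuring pairing `κ : A → C^*`, the functor sending a right comodule `M` to the left
`A`-module `M` with `a m = ∑ m₀ ⟨a, m₁⟩`, and being the identity on maps. -/
noncomputable def rightComodToMod (κ : A →ₙₐ[R] DualAlg R C) : RightComod R C ⥤ NUMod R A where
  obj M :=
    { carrier := M.carrier
      act :=
        { toFun := fun a => rightEnd M (κ a).ofConv
          map_smul' := fun r a => by
            simp [rightEnd, LinearMap.lTensor_smul, LinearMap.smul_comp, LinearMap.comp_smul]
          map_zero' := by simp [rightEnd]
          map_add' := fun a b => by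
            simp [rightEnd, LinearMap.lTensor_add, LinearMap.add_comp, LinearMap.comp_add]
          map_mul' := fun a b => by rw [map_mul, rightEnd_mul] } }
  map {M N} f :=
    { lin := f.lin
      map_act := fun a m => by
        have h := LinearMap.congr_fun f.colinear m
        simp only [LinearMap.comp_apply] at h
        change f.lin (rightEnd M _ m) = rightEnd N _ (f.lin m)
        simp only [rightEnd, LinearMap.comp_apply, LinearEquiv.coe_coe, h]
        generalize M.coact m = z
        induction z with
        | zero => simp
        | add a b ha hb => simp only [map_add, ha, hb]
        | tmul n d => simp }

/-- For a measuring pairing `κ : A → C^*`, the functor sending a left comodule `M` to the right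
`A`-module `M` with `m a = ∑ ⟨a, m₋₁⟩ m₀`, and being the identity on maps. -/
noncomputable def leftComodToMod (κ : A →ₙₐ[R] DualAlg R C) :
    LeftComod R C ⥤ NUMod R Aᵐᵒᵖ where
  obj M :=
    { carrier := M.carrier
      act :=
        { toFun := fun a => leftEnd M (κ a.unop).ofConv
          map_smul' := fun r a => by
            simp [leftEnd, LinearMap.rTensor_smul, LinearMap.smul_comp, LinearMap.comp_smul]
          map_zero' := by simp [leftEnd]
          map_add' := fun a b => by
            simp [leftEnd, LinearMap.rTensor_add, LinearMap.add_comp, LinearMap.comp_add]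
          map_mul' := fun a b => by rw [MulOpposite.unop_mul, map_mul, leftEnd_mul] } }
  map {M N} f :=
    { lin := f.lin
      map_act := fun a m => by
        have h := LinearMap.congr_fun f.colinear m
        simp only [LinearMap.comp_apply] at h
        change f.lin (leftEnd M _ m) = leftEnd N _ (f.lin m)
        simp only [leftEnd, LinearMap.comp_apply, LinearEquiv.coe_coe, h]
        generalize M.coact m = z
        induction z with
        | zero => simp
        | add a b ha hb => simp only [map_add, ha, hb]
        | tmul d n => simp }

/-- `C` as a left `A`-module: `a ⇀ c = ∑ c₁ ⟨a, c₂⟩`. -/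
noncomputable def leftMod (κ : A →ₙₐ[R] DualAlg R C) : NUMod R A :=
  (rightComodToMod κ).obj (RightComod.self R C)

/-- `C` as a right `A`-module: `c ↼ a = ∑ ⟨a, c₁⟩ c₂`. -/
noncomputable def rightMod (κ : A →ₙₐ[R] DualAlg R C) : NUMod R Aᵐᵒᵖ :=
  (leftComodToMod κ).obj (LeftComod.self R C)

variable (R C) in
/-- The pairing `(C^*, C)`. -/
noncomputable abbrev dualPairing : DualAlg R C →ₙₐ[R] DualAlg R C := NonUnitalAlgHom.id R (DualAlg R C)

/-- `M^C ≃ σ[_A C] = σ[_{C^*} C]`: the canonical functor from right comodules is an isomorphism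
onto `σ[_A C]`, and so is restriction of scalars along `κ` from `σ[_{C^*} C]`. -/
def RightComodIsSigma (κ : A →ₙₐ[R] DualAlg R C) : Prop :=
  IsIsoOntoFull (rightComodToMod κ) (leftMod κ).sigma ∧
  IsIsoOntoFull ((leftMod (dualPairing R C)).sigma.ι ⋙ NUMod.restrict κ) (leftMod κ).sigma

/-- `^C M ≃ σ[C_A] = σ[C_{C^*}]`, in the same sense. -/
def LeftComodIsSigma (κ : A →ₙₐ[R] DualAlg R C) : Prop :=
  IsIsoOntoFull (leftComodToMod κ) (rightMod κ).sigma ∧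
  IsIsoOntoFull ((rightMod (dualPairing R C)).sigma.ι ⋙ NUMod.restrict (opHom κ))
    (rightMod κ).sigma

/-- The map `α_M : M ⊗ W → Hom(V, M)`, `∑ mᵢ ⊗ wᵢ ↦ [v ↦ ∑ mᵢ ⟨v, wᵢ⟩]` of a pairing
`V → W^*`. -/
noncomputable def alphaMap {V W : Type u} [AddCommGroup V] [Module R V] [AddCommGroup W]
    [Module R W] (κ : V →ₗ[R] W →ₗ[R] R) (M : Type u) [AddCommGroup M] [Module R M] :
    M ⊗[R] W →ₗ[R] V →ₗ[R] M :=
  TensorProduct.lift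
    (LinearMap.mk₂ R (fun m w => (κ.flip w).smulRight m)
      (fun m m' w => by ext v; simp)
      (fun r m w => by ext v; exact smul_comm _ _ _)
      (fun m w w' => by ext v; simp [add_smul])
      (fun r m w => by ext v; simp [mul_smul]))

/-- The `α`-condition for a pairing `V → W^*`. -/
def AlphaCondition {V W : Type u} [AddCommGroup V] [Module R V] [AddCommGroup W]
    [Module R W] (κ : V →ₗ[R] W →ₗ[R] R) : Prop :=
  ∀ (M : Type u) [AddCommGroup M] [Module R M], Function.Injective (alphaMap κ M)

/-- The linear map `A → C^*` underlying a measuring pairing. -/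
noncomputable def toPairing (κ : A →ₙₐ[R] DualAlg R C) : A →ₗ[R] C →ₗ[R] R where
  toFun a := (κ a).ofConv
  map_add' a b := by simp
  map_smul' r a := by simp

variable (R) in
/-- `W` is locally projective: given a linear surjection `g : L → N`, a linear map `f : W → N`
and a finitely generated submodule `F` of `W`, there is `h : W → L` with `g ∘ h = f` on `F`. -/
def LocallyProjective (W : Type u) [AddCommGroup W] [Module R W] : Prop :=
  ∀ (L N : Type u) [AddCommGroup L] [Module R L] [AddCommGroup N] [Module R N]
    (g : L →ₗ[R] N) (f : W →ₗ[R] N), Function.Surjective g →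
    ∀ F : Submodule R W, F.FG → ∃ h : W →ₗ[R] L, ∀ x ∈ F, g (h x) = f x

variable (R) in
/-- The finite topology on `W^*`: induced from the product topology on `R^W`, `R` discrete. -/
@[reducible] def finiteTopology (W : Type u) [AddCommGroup W] [Module R W] : TopologicalSpace (W →ₗ[R] R) :=
  TopologicalSpace.induced (fun f : W →ₗ[R] R => (f : W → R))
    (@Pi.topologicalSpace W (fun _ => R) (fun _ => ⊥))

/-- `κ(V)` is dense in `W^*` for the finite topology. -/
def DenseImage {V W : Type u} [AddCommGroup V] [Module R V] [AddCommGroup W]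
    [Module R W] (κ : V →ₗ[R] W →ₗ[R] R) : Prop :=
  @Dense _ (finiteTopology R W) (Set.range κ)

end Pairings

end MeasuringPairing

/-! The α-condition is the pivot: each of the other conditions is shown equivalent to it.

Local projectivity and density (`alphaCondition_iff`): injectivity of α for quotients of R^n gives
any finite family in C an expansion c_i = ∑ ⟨a_j, c_i⟩ d_j with a_j in A. Such local dual bases lift
maps and approximate functionals. Conversely, local projectivity gives expansions whose coefficients
are functionals, density moves these into A, and a tensor in M ⊗ C can then be rebuilt from its
image under α.

From α to categories (`AlphaCondition.isIsoOntoFull`): in a C-subgenerated module N, the action on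
each n comes from a tensor in N ⊗ C. By α this tensor is unique, so it defines a coaction, and
A-linear maps between comodules are colinear. The α-condition passes from A to C^*, and cancelling
the two resulting isomorphisms compares the two σ-categories.

Back to α (`alphaCondition_of_isIsoOntoFull`): K = ker α_M is an A-submodule of the cofree comodule
M ⊗ C. The comparison of σ-categories makes K a C^*-submodule, hence AK = K and the inclusion of K
is colinear for some coaction. But id ⊗ ε sends aw to α(w)(a), so it kills AK = K, and a colinear
map into M ⊗ C is determined by its composite with id ⊗ ε. Hence K = 0.

Left comodules are right comodules over the co-opposite coalgebra, and the α-condition is the same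
for both. -/

namespace MeasuringPairing

/-! ### Strict isomorphisms onto full subcategories -/

section Categories

universe v₁ v₂ v₃ u₁ u₂ u₃

variable {X : Type u₁} [Category.{v₁} X] {Y : Type u₂} [Category.{v₂} Y]
  {Z : Type u₃} [Category.{v₃} Z]

/-- A functor with a strict inverse is full, faithful and bijective on objects. -/
lemma IsCatIso.full_faithful_bijective {F : X ⥤ Y} (h : IsCatIso F) :
    F.Full ∧ F.Faithful ∧ Function.Bijective F.obj := by
  obtain ⟨G, h₁, h₂⟩ := h
  let e : X ≌ Y := CategoryTheory.Equivalence.mk F G (eqToIso h₁.symm) (eqToIso h₂)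
  refine ⟨e.full_functor, e.faithful_functor, fun a b hab => ?_, fun y => ⟨G.obj y, ?_⟩⟩
  · have ha := Functor.congr_obj h₁ a
    have hb := Functor.congr_obj h₁ b
    simp only [Functor.comp_obj, Functor.id_obj] at ha hb
    rw [← ha, ← hb, hab]
  · exact Functor.congr_obj h₂ y

/-- A fully faithful functor that is bijective on objects has a strict inverse. -/
lemma isCatIso_of_bijective (F : X ⥤ Y) [F.Full] [F.Faithful] (h : Function.Bijective F.obj) :
    IsCatIso F := by
  obtain ⟨g, hgF, hFg⟩ := Function.bijective_iff_has_inverse.1 h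
  let G : Y ⥤ X :=
    { obj := g
      -- The objects `F.obj (g a)` and `a` are only propositionally equal, so `f` is transported
      -- before a preimage is taken.
      map := fun {a b} f => F.preimage (eqToHom (hFg a) ≫ f ≫ eqToHom (hFg b).symm)
      map_id := fun a => F.map_injective (by simp)
      map_comp := fun f f' => F.map_injective (by simp) }
  refine ⟨G, CategoryTheory.Functor.ext hgF fun a b f => F.map_injective ?_, CategoryTheory.Functor.ext hFg fun a b f => ?_⟩
  · simp [G, eqToHom_map]
  · simp [G]

/-- `F` is an isomorphism onto the full subcategory cut out by `P` exactly when it is fully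
faithful, injective on objects, and its objects are those satisfying `P`. -/
lemma isIsoOntoFull_iff (F : X ⥤ Y) (P : ObjectProperty Y) :
    IsIsoOntoFull F P ↔ (∀ M, P (F.obj M)) ∧ F.Full ∧ F.Faithful ∧
      Function.Injective F.obj ∧ ∀ N, P N → ∃ M, F.obj M = N := by
  constructor
  · rintro ⟨h, hiso⟩
    obtain ⟨hfull, hfaith, hinj, hsurj⟩ := hiso.full_faithful_bijective
    refine ⟨h, ⟨fun {a b} f => ?_⟩, ⟨fun {a b f g} hfg => ?_⟩, fun a b hab => hinj ?_,
      fun N hN => ?_⟩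
    · obtain ⟨g, hg⟩ := (P.lift F h).map_surjective (ObjectProperty.homMk f :
        (P.lift F h).obj a ⟶ (P.lift F h).obj b)
      exact ⟨g, congrArg P.ι.map hg⟩
    · exact (P.lift F h).map_injective (InducedCategory.hom_ext hfg)
    · exact ObjectProperty.FullSubcategory.ext hab
    · obtain ⟨M, hM⟩ := hsurj ⟨N, hN⟩
      exact ⟨M, congrArg ObjectProperty.FullSubcategory.obj hM⟩
  · rintro ⟨h, _, _, hinj, hsurj⟩
    refine ⟨h, isCatIso_of_bijective _ ⟨fun a b hab => hinj ?_, fun N => ?_⟩⟩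
    · exact congrArg ObjectProperty.FullSubcategory.obj hab
    · obtain ⟨M, hM⟩ := hsurj N.obj N.property
      exact ⟨M, ObjectProperty.FullSubcategory.ext hM⟩

/-- Cancellation of isomorphisms onto full subcategories. -/
lemma IsIsoOntoFull.of_comp {F : X ⥤ Y} {P : ObjectProperty Y} {T : Y ⥤ Z}
    {Q : ObjectProperty Z} (hF : IsIsoOntoFull F P) (hFT : IsIsoOntoFull (F ⋙ T) Q) :
    IsIsoOntoFull (P.ι ⋙ T) Q := by
  rw [isIsoOntoFull_iff] at *
  obtain ⟨hP, _, _, -, hFs⟩ := hF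
  obtain ⟨hQ, _, _, hi, hs⟩ := hFT
  -- Every object of the full subcategory equals some `F.obj M`; substituting this removes all
  -- transports below.
  have key : ∀ N : P.FullSubcategory, ∃ M, N = ⟨F.obj M, hP M⟩ := fun N => by
    obtain ⟨M, hM⟩ := hFs N.obj N.property
    exact ⟨M, ObjectProperty.FullSubcategory.ext hM.symm⟩
  refine ⟨fun N => ?_, ⟨fun {a b} f => ?_⟩, ⟨fun {a b f g} hfg => ?_⟩, fun a b hab => ?_,
    fun N hN => ?_⟩
  · obtain ⟨M, rfl⟩ := key N
    exact hQ M
  · obtain ⟨a, rfl⟩ := key a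
    obtain ⟨b, rfl⟩ := key b
    obtain ⟨g, hg⟩ := (F ⋙ T).map_surjective (X := a) (Y := b) f
    exact ⟨ObjectProperty.homMk (F.map g), hg⟩
  · obtain ⟨a, rfl⟩ := key a
    obtain ⟨b, rfl⟩ := key b
    obtain ⟨f', hf⟩ := F.map_surjective f.hom
    obtain ⟨g', hg⟩ := F.map_surjective g.hom
    have : f' = g' := (F ⋙ T).map_injective (by
      change T.map f.hom = T.map g.hom at hfg
      simpa only [Functor.comp_map, hf, hg] using hfg)
    exact InducedCategory.hom_ext (by rw [← hf, ← hg, this])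
  · obtain ⟨a, rfl⟩ := key a
    obtain ⟨b, rfl⟩ := key b
    obtain rfl := hi hab
    rfl
  · obtain ⟨M, hM⟩ := hs N hN
    exact ⟨⟨F.obj M, hP M⟩, hM⟩

/-- Precomposition with an isomorphism of categories. -/
lemma isIsoOntoFull_comp_iff (E : X ⥤ Y) [E.Full] [E.Faithful] (hE : Function.Bijective E.obj)
    (F : Y ⥤ Z) (P : ObjectProperty Z) : IsIsoOntoFull (E ⋙ F) P ↔ IsIsoOntoFull F P := by
  simp only [isIsoOntoFull_iff]
  constructor
  · rintro ⟨h, _, _, hi, hs⟩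
    refine ⟨fun M => ?_, ⟨fun {a b} f => ?_⟩, ⟨fun {a b f g} hfg => ?_⟩, fun a b hab => ?_,
      fun N hN => ?_⟩
    · obtain ⟨M, rfl⟩ := hE.2 M
      exact h M
    · obtain ⟨a, rfl⟩ := hE.2 a
      obtain ⟨b, rfl⟩ := hE.2 b
      obtain ⟨g, hg⟩ := (E ⋙ F).map_surjective (X := a) (Y := b) f
      exact ⟨E.map g, hg⟩
    · obtain ⟨a, rfl⟩ := hE.2 a
      obtain ⟨b, rfl⟩ := hE.2 b
      obtain ⟨f', rfl⟩ := E.map_surjective f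
      obtain ⟨g', rfl⟩ := E.map_surjective g
      rw [(E ⋙ F).map_injective (a₁ := f') (a₂ := g') hfg]
    · obtain ⟨a, rfl⟩ := hE.2 a
      obtain ⟨b, rfl⟩ := hE.2 b
      rw [hi hab]
    · obtain ⟨M, hM⟩ := hs N hN
      exact ⟨E.obj M, hM⟩
  · rintro ⟨h, _, _, hi, hs⟩
    refine ⟨fun M => h _, inferInstance, inferInstance, hi.comp hE.1, fun N hN => ?_⟩
    obtain ⟨M, rfl⟩ := hs N hN
    obtain ⟨M, rfl⟩ := hE.2 M
    exact ⟨M, rfl⟩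

end Categories

end MeasuringPairing

namespace MeasuringPairing

/-! ### The α-condition, local projectivity and density -/

section Alpha

variable {R V W : Type u} [CommRing R] [AddCommGroup V] [Module R V] [AddCommGroup W]
  [Module R W]

@[simp]
lemma alphaMap_tmul (κ : V →ₗ[R] W →ₗ[R] R) {M : Type u} [AddCommGroup M] [Module R M]
    (m : M) (w : W) (v : V) : alphaMap κ M (m ⊗ₜ w) v = κ v w • m := rfl

lemma alphaMap_apply (κ : V →ₗ[R] W →ₗ[R] R) {M : Type u} [AddCommGroup M] [Module R M]
    (z : M ⊗[R] W) (v : V) :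
    alphaMap κ M z v = TensorProduct.rid R M ((κ v).lTensor M z) := by
  induction z with
  | zero => simp
  | add x y hx hy => simp only [map_add, LinearMap.add_apply, hx, hy]
  | tmul m w => simp

lemma alphaMap_rTensor (κ : V →ₗ[R] W →ₗ[R] R) {M N : Type u} [AddCommGroup M] [Module R M]
    [AddCommGroup N] [Module R N] (f : M →ₗ[R] N) (z : M ⊗[R] W) (v : V) :
    alphaMap κ N (f.rTensor W z) v = f (alphaMap κ M z v) := by
  induction z with
  | zero => simp
  | add x y hx hy => simp only [map_add, LinearMap.add_apply, hx, hy]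
  | tmul m w => simp

lemma rid_lTensor_rTensor (f : W →ₗ[R] R) {M N : Type u} [AddCommGroup M] [Module R M]
    [AddCommGroup N] [Module R N] (g : M →ₗ[R] N) (z : M ⊗[R] W) :
    TensorProduct.rid R N (f.lTensor N (g.rTensor W z)) =
      g (TensorProduct.rid R M (f.lTensor M z)) := by
  induction z with
  | zero => simp
  | add x y hx hy => simp only [map_add, hx, hy]
  | tmul m w => simp

/-- The kernel of α depends only on the set of functionals `κ v`, and more functionals make it
smaller. -/
lemma AlphaCondition.of_range_subset {V' : Type u} [AddCommGroup V'] [Module R V']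
    {κ : V →ₗ[R] W →ₗ[R] R} {κ' : V' →ₗ[R] W →ₗ[R] R} (h : AlphaCondition κ)
    (hκ : Set.range κ ⊆ Set.range κ') : AlphaCondition κ' := by
  intro M _ _
  refine (injective_iff_map_eq_zero _).2 fun z hz => (injective_iff_map_eq_zero _).1 (h M) z ?_
  ext v
  obtain ⟨v', hv'⟩ := hκ ⟨v, rfl⟩
  have := LinearMap.congr_fun hz v'
  rw [alphaMap_apply] at this ⊢
  rwa [hv'] at this

/-- The elements of a finite family in `W` have dual expansions with coefficients in `V`. -/
def HasLocalDualBases (κ : V →ₗ[R] W →ₗ[R] R) : Prop :=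
  ∀ (n : ℕ) (c : Fin n → W), ∃ (k : ℕ) (a : Fin k → V) (d : Fin k → W),
    ∀ i, ∑ j, κ (a j) (c i) • d j = c i

/-- Let U ⊆ R^n be the set of tuples (⟨v, c_i⟩)_i. The tensor z = ∑ e_i ⊗ c_i is killed by α over
R^n/U, hence vanishes in (R^n/U) ⊗ W. By right exactness it lifts to V ⊗ W, and the i-th coordinate
of a lift is the expansion of c_i. -/
lemma AlphaCondition.hasLocalDualBases {κ : V →ₗ[R] W →ₗ[R] R} (h : AlphaCondition κ) :
    HasLocalDualBases κ := by
  intro n c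
  let ev : V →ₗ[R] Fin n → R := LinearMap.pi fun i => κ.flip (c i)
  let U := LinearMap.range ev
  let z : (Fin n → R) ⊗[R] W := ∑ i, Pi.single i 1 ⊗ₜ c i
  have hz : U.mkQ.rTensor W z = 0 := by
    refine (injective_iff_map_eq_zero _).1 (h (_ ⧸ U)) _ (LinearMap.ext fun v => ?_)
    rw [alphaMap_rTensor, LinearMap.zero_apply, Submodule.mkQ_apply,
      Submodule.Quotient.mk_eq_zero]
    refine ⟨v, ?_⟩
    simp only [z, map_sum, LinearMap.sum_apply, alphaMap_tmul]
    ext i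
    simp [ev, Pi.single_apply]
  have hex : Function.Exact ev U.mkQ := by
    rw [LinearMap.exact_iff, Submodule.ker_mkQ]
  obtain ⟨y, hy⟩ := (rTensor_exact W hex U.mkQ_surjective z).1 hz
  obtain ⟨k, a, d, rfl⟩ : ∃ (k : ℕ) (a : Fin k → V) (d : Fin k → W), y = ∑ j, a j ⊗ₜ d j := by
    obtain ⟨s, rfl⟩ := TensorProduct.exists_finset y
    refine ⟨s.card, fun j => (s.equivFin.symm j).1.1, fun j => (s.equivFin.symm j).1.2, ?_⟩
    rw [← Finset.sum_coe_sort]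
    exact (Equiv.sum_comp s.equivFin.symm (fun i : s => i.1.1 ⊗ₜ[R] i.1.2)).symm
  refine ⟨k, a, d, fun i => ?_⟩
  have := congrArg ((TensorProduct.lid R W).toLinearMap ∘ₗ
    (LinearMap.proj (R := R) (φ := fun _ => R) i).rTensor W) hy
  simpa [z, ev, Pi.single_apply, ite_smul] using this

/-- Lift each f(d_j) to l_j in L and take h = ∑ ⟨a_j, -⟩ l_j. -/
lemma HasLocalDualBases.locallyProjective {κ : V →ₗ[R] W →ₗ[R] R} (h : HasLocalDualBases κ) :
    LocallyProjective R W := by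
  intro L N _ _ _ _ g f hg F hF
  obtain ⟨n, c, rfl⟩ := Submodule.fg_iff_exists_fin_generating_family.1 hF
  obtain ⟨k, a, d, had⟩ := h n c
  choose l hl using fun j => hg (f (d j))
  refine ⟨∑ j, (κ (a j)).smulRight (l j), fun x hx => ?_⟩
  have : Set.EqOn (g ∘ₗ ∑ j, (κ (a j)).smulRight (l j)) f (Set.range c) := by
    rintro _ ⟨i, rfl⟩
    conv_rhs => rw [← had i]
    simp [hl]
  exact LinearMap.eqOn_span this hx

lemma finiteTopology_dense_iff (S : Set (W →ₗ[R] R)) :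
    @Dense _ (finiteTopology R W) S ↔
      ∀ (f : W →ₗ[R] R) (T : Finset W), ∃ g ∈ S, ∀ c ∈ T, g c = f c := by
  let _ : TopologicalSpace R := ⊥
  have : DiscreteTopology R := ⟨rfl⟩
  let _ := finiteTopology R W
  constructor
  · intro h f T
    have ho : IsOpen {g : W →ₗ[R] R | ∀ c ∈ T, g c = f c} := by
      refine isOpen_induced_iff.2 ⟨(T : Set W).pi fun c => {f c},
        isOpen_set_pi T.finite_toSet fun _ _ => isOpen_discrete _, ?_⟩
      ext g
      simp
    obtain ⟨g, hg, hgS⟩ := h.inter_open_nonempty _ ho ⟨f, fun _ _ => rfl⟩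
    exact ⟨g, hgS, hg⟩
  · intro h
    refine dense_iff_inter_open.2 fun U hU hne => ?_
    obtain ⟨f, hf⟩ := hne
    obtain ⟨O, hO, rfl⟩ := isOpen_induced_iff.1 hU
    obtain ⟨T, u, hu, hsub⟩ := isOpen_pi_iff.1 hO f hf
    obtain ⟨g, hgS, hg⟩ := h f T
    refine ⟨g, hsub fun c hc => ?_, hgS⟩
    change g c ∈ u c
    rw [hg c hc]
    exact (hu c hc).2

lemma HasLocalDualBases.denseImage {κ : V →ₗ[R] W →ₗ[R] R} (h : HasLocalDualBases κ) :
    DenseImage κ := by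
  refine (finiteTopology_dense_iff _).2 fun f T => ?_
  obtain ⟨k, a, d, had⟩ := h T.card fun i => T.equivFin.symm i
  -- Applying `f` to the expansion of `c` shows which element of `V` agrees with `f` there.
  refine ⟨_, ⟨∑ j, f (d j) • a j, rfl⟩, fun c hc => ?_⟩
  have := had (T.equivFin ⟨c, hc⟩)
  simp only [Equiv.symm_apply_apply] at this
  conv_rhs => rw [← this]
  simp [mul_comm]

lemma alphaCondition_of_locallyProjective_of_denseImage {κ : V →ₗ[R] W →ₗ[R] R}
    (h : LocallyProjective R W) (hd : DenseImage κ) : AlphaCondition κ := by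
  intro M _ _
  refine (injective_iff_map_eq_zero _).2 fun z hz => ?_
  classical
  obtain ⟨s, rfl⟩ := TensorProduct.exists_finset z
  let T : Finset W := s.image Prod.snd
  -- A section, over the span of `T`, of the free module on the set `W`; its coordinates are the
  -- coefficient functionals.
  obtain ⟨p, hp⟩ := h (W →₀ R) W (Finsupp.linearCombination R id) LinearMap.id
    (Finsupp.linearCombination_id_surjective R W) (Submodule.span R T) ⟨T, rfl⟩
  let D : Finset W := T.biUnion fun c => (p c).support
  have hexp : ∀ c ∈ T, ∑ d ∈ D, p c d • d = c := fun c hc => by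
    have := hp c (Submodule.subset_span hc)
    rw [Finsupp.linearCombination_apply, Finsupp.sum_of_support_subset (s := D) _
      (Finset.subset_biUnion_of_mem (fun c => (p c).support) hc) _ (by simp)] at this
    simpa using this
  -- Density replaces each coordinate functional by some `κ (a d)` with the same values on `T`.
  choose g hg hgp using fun d : W =>
    (finiteTopology_dense_iff _).1 hd (Finsupp.lapply d ∘ₗ p) T
  choose a ha using hg
  have hT : ∀ i ∈ s, i.2 ∈ T := fun i hi => Finset.mem_image_of_mem _ hi
  calc ∑ i ∈ s, i.1 ⊗ₜ[R] i.2 = ∑ i ∈ s, ∑ d ∈ D, (κ (a d) i.2 • i.1) ⊗ₜ[R] d := by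
        refine Finset.sum_congr rfl fun i hi => ?_
        conv_lhs => rw [← hexp i.2 (hT i hi), TensorProduct.tmul_sum]
        refine Finset.sum_congr rfl fun d _ => ?_
        rw [ha, hgp d i.2 (hT i hi), TensorProduct.smul_tmul]
        rfl
    _ = ∑ d ∈ D, alphaMap κ M (∑ i ∈ s, i.1 ⊗ₜ[R] i.2) (a d) ⊗ₜ[R] d := by
        rw [Finset.sum_comm]
        refine Finset.sum_congr rfl fun d _ => ?_
        simp [TensorProduct.sum_tmul]
    _ = 0 := by simp [hz]

/-- The `α`-condition holds exactly when `W` is locally projective and the image is dense. -/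
lemma alphaCondition_iff (κ : V →ₗ[R] W →ₗ[R] R) :
    AlphaCondition κ ↔ LocallyProjective R W ∧ DenseImage κ :=
  ⟨fun h => ⟨h.hasLocalDualBases.locallyProjective, h.hasLocalDualBases.denseImage⟩,
    fun h => alphaCondition_of_locallyProjective_of_denseImage h.1 h.2⟩

end Alpha

end MeasuringPairing

namespace MeasuringPairing

variable {R A C : Type u} [CommRing R] [NonUnitalRing A] [Module R A]
  [AddCommGroup C] [Module R C] [Coalgebra R C]

/-! ### Rational modules and their coactions -/

section Rational

lemma NUMod.ext_act {N : NUMod R A} {act : A →ₙₐ[R] Module.End R N.carrier}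
    (h : ∀ a n, act a n = N.act a n) : (⟨N.carrier, act⟩ : NUMod R A) = N := by
  have : act = N.act := NonUnitalAlgHom.ext fun a => LinearMap.ext (h a)
  rw [this]

lemma rightComodToMod_act (κ : A →ₙₐ[R] DualAlg R C) (M : RightComod R C) (a : A)
    (m : M.carrier) : ((rightComodToMod κ).obj M).act a m =
      alphaMap (toPairing κ) M.carrier (M.coact m) a := by
  change rightEnd M (κ a).ofConv m = _
  rw [alphaMap_apply]
  rfl

/-- Coassociativity and the counit law of C show that m and (id ⊗ ε)ρ(m) have the same image under
ρ; injectivity of ρ then gives the counit law of the comodule. -/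
lemma RightComod.rid_counit_coact (M : RightComod R C) (m : M.carrier) :
    TensorProduct.rid R M.carrier
      ((Coalgebra.counit (R := R) (A := C)).lTensor M.carrier (M.coact m)) = m := by
  apply M.counital
  rw [← rid_lTensor_rTensor]
  have key : ∀ y : (M.carrier ⊗[R] C) ⊗[R] C,
      TensorProduct.rid R _ ((Coalgebra.counit (R := R) (A := C)).lTensor _ y) =
      ((TensorProduct.rid R C).toLinearMap ∘ₗ
        (Coalgebra.counit (R := R) (A := C)).lTensor C).lTensor M.carrier
          (TensorProduct.assoc R M.carrier C C y) := by
    intro y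
    induction y with
    | zero => simp
    | add a b ha hb => simp only [map_add, ha, hb]
    | tmul z d =>
      induction z with
      | zero => simp
      | add a b ha hb => simp only [TensorProduct.add_tmul, map_add, ha, hb]
      | tmul m c => simp
  have h := LinearMap.congr_fun M.coassoc m
  simp only [LinearMap.comp_apply, LinearEquiv.coe_coe] at h
  rw [key, h, ← LinearMap.comp_apply (LinearMap.lTensor _ _), ← LinearMap.lTensor_comp]
  have hid : ((TensorProduct.rid R C).toLinearMap ∘ₗ
      (Coalgebra.counit (R := R) (A := C)).lTensor C) ∘ₗ Coalgebra.comul = LinearMap.id :=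
    LinearMap.ext fun c => by simp
  rw [hid, LinearMap.lTensor_id, LinearMap.id_apply]

/-- The action on `n` comes from an element of `N ⊗ C` whose image under the counit is `n`. -/
def IsRational (κ : A →ₙₐ[R] DualAlg R C) (N : NUMod R A) (n : N.carrier) : Prop :=
  ∃ z : N.carrier ⊗[R] C, (∀ a, alphaMap (toPairing κ) N.carrier z a = N.act a n) ∧
    TensorProduct.rid R N.carrier
      ((Coalgebra.counit (R := R) (A := C)).lTensor N.carrier z) = n

variable {κ : A →ₙₐ[R] DualAlg R C}

lemma IsRational.of_comod (M : RightComod R C) (m : M.carrier) :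
    IsRational κ ((rightComodToMod κ).obj M) m :=
  ⟨M.coact m, fun a => (rightComodToMod_act κ M a m).symm, M.rid_counit_coact m⟩

lemma IsRational.zero (N : NUMod R A) : IsRational κ N 0 := ⟨0, by simp, by simp⟩

lemma IsRational.add {N : NUMod R A} {m n : N.carrier} :
    IsRational κ N m → IsRational κ N n → IsRational κ N (m + n) := by
  rintro ⟨z, hz, hz'⟩ ⟨w, hw, hw'⟩
  exact ⟨z + w, fun a => by simp only [map_add, LinearMap.add_apply, hz, hw],
    by rw [map_add, map_add, hz', hw']⟩

lemma IsRational.map {M N : NUMod R A} (f : M ⟶ N) {m : M.carrier} :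
    IsRational κ M m → IsRational κ N (f.lin m) := by
  rintro ⟨z, hz, hz'⟩
  exact ⟨f.lin.rTensor C z, fun a => by rw [alphaMap_rTensor, hz, f.map_act],
    by rw [rid_lTensor_rTensor, hz']⟩

/-- Among the closure properties, this one needs α: the tensor for i(n) acts trivially modulo N, so
it dies in (L/N) ⊗ C and lifts to N ⊗ C. -/
lemma IsRational.of_injective (hα : AlphaCondition (toPairing κ)) {N L : NUMod R A} (i : N ⟶ L)
    (hi : Function.Injective i.lin) {n : N.carrier} :
    IsRational κ L (i.lin n) → IsRational κ N n := by
  rintro ⟨z, hz, hz'⟩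
  let q := (LinearMap.range i.lin).mkQ
  have hq : q.rTensor C z = 0 := by
    refine (injective_iff_map_eq_zero _).1 (hα _) _ (LinearMap.ext fun a => ?_)
    rw [alphaMap_rTensor, hz, ← i.map_act, LinearMap.zero_apply, Submodule.mkQ_apply,
      Submodule.Quotient.mk_eq_zero]
    exact ⟨_, rfl⟩
  have hex : Function.Exact i.lin q := by rw [LinearMap.exact_iff, Submodule.ker_mkQ]
  obtain ⟨w, rfl⟩ := (rTensor_exact C hex (Submodule.mkQ_surjective _) z).1 hq
  refine ⟨w, fun a => hi ?_, hi ?_⟩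
  · rw [← alphaMap_rTensor, hz, i.map_act]
  · rw [← rid_lTensor_rTensor, hz']

lemma IsRational.of_copower {K : NUMod R A} (hK : ∀ x, IsRational κ K x) (Λ : Type u)
    (x : (NUMod.copower Λ K).carrier) : IsRational κ (NUMod.copower Λ K) x := by
  induction x using Finsupp.induction_linear with
  | zero => exact IsRational.zero _
  | add x y hx hy => exact hx.add hy
  | single l k =>
    let f : NUMod.Hom K (NUMod.copower Λ K) :=
      ⟨Finsupp.lsingle l, fun a m => by
        simp only [NUMod.copower]
        exact (Finsupp.mapRange_single (hf := map_zero _)).symm⟩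
    exact IsRational.map (N := NUMod.copower Λ K) f (hK k)

lemma IsRational.of_isSubgenerated (hα : AlphaCondition (toPairing κ)) {N : NUMod R A}
    (h : NUMod.IsSubgenerated (leftMod κ) N) (n : N.carrier) : IsRational κ N n := by
  obtain ⟨L, ⟨Λ, p, hp⟩, i, hi⟩ := h
  refine IsRational.of_injective hα i hi ?_
  obtain ⟨x, hx⟩ := hp (i.lin n)
  rw [← hx]
  exact (IsRational.of_copower (fun c => IsRational.of_comod (RightComod.self R C) c) Λ x).map p

/-- The coaction on a rational module. -/
noncomputable def rationalCoact (hα : AlphaCondition (toPairing κ)) (N : NUMod R A)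
    (h : ∀ n, IsRational κ N n) : N.carrier →ₗ[R] N.carrier ⊗[R] C where
  -- Injectivity of α makes the chosen tensor unique, hence the choice linear.
  toFun n := (h n).choose
  map_add' m n := hα _ (LinearMap.ext fun a => by
    rw [(h (m + n)).choose_spec.1, map_add, map_add, LinearMap.add_apply,
      (h m).choose_spec.1, (h n).choose_spec.1])
  map_smul' r n := hα _ (LinearMap.ext fun a => by
    rw [(h (r • n)).choose_spec.1, map_smul, map_smul, LinearMap.smul_apply,
      (h n).choose_spec.1, RingHom.id_apply])

lemma alphaMap_rationalCoact (hα : AlphaCondition (toPairing κ)) (N : NUMod R A)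
    (h : ∀ n, IsRational κ N n) (n : N.carrier) (a : A) :
    alphaMap (toPairing κ) N.carrier (rationalCoact hα N h n) a = N.act a n :=
  (h n).choose_spec.1 a

/-- The inner α pairs the last leg with a and the outer one pairs the middle leg with b, so the
convolution product appears as b * a. -/
lemma alphaMap_alphaMap_comul (κ : A →ₙₐ[R] DualAlg R C) {M : Type u} [AddCommGroup M]
    [Module R M] (w : M ⊗[R] C) (a b : A) :
    alphaMap (toPairing κ) M (alphaMap (toPairing κ) (M ⊗[R] C)
      ((TensorProduct.assoc R M C C).symm (Coalgebra.comul.lTensor M w)) a) b =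
    alphaMap (toPairing κ) M w (b * a) := by
  induction w with
  | zero => simp
  | add x y hx hy => simp only [map_add, LinearMap.add_apply, hx, hy]
  | tmul m c =>
    have key : ∀ y : C ⊗[R] C, alphaMap (toPairing κ) M (alphaMap (toPairing κ) (M ⊗[R] C)
        ((TensorProduct.assoc R M C C).symm (m ⊗ₜ y)) a) b =
        LinearMap.mul' R R (TensorProduct.map (κ b).ofConv (κ a).ofConv y) • m := by
      intro y
      induction y with
      | zero => simp
      | add x y hx hy =>
        simp only [TensorProduct.tmul_add, map_add, LinearMap.add_apply, hx, hy, add_smul]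
      | tmul c d => simp [toPairing, smul_smul, mul_comm]
    rw [LinearMap.lTensor_tmul, key, alphaMap_tmul]
    simp [toPairing, LinearMap.convMul_apply]

/-- The comodule structure on a rational module. -/
noncomputable def rationalComod (hα : AlphaCondition (toPairing κ)) (N : NUMod R A)
    (h : ∀ n, IsRational κ N n) : RightComod R C where
  carrier := N.carrier
  coact := rationalCoact hα N h
  coassoc := by
    refine LinearMap.ext fun n => ?_
    simp only [LinearMap.comp_apply, LinearEquiv.coe_coe]
    rw [← LinearEquiv.eq_symm_apply]
    -- Tested against `a` and `b`, coassociativity becomes b(an) = (ba)n.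
    refine hα _ (LinearMap.ext fun a => hα _ (LinearMap.ext fun b => ?_))
    rw [alphaMap_alphaMap_comul, alphaMap_rTensor]
    simp only [alphaMap_rationalCoact, map_mul, Module.End.mul_apply]
  counital := Function.LeftInverse.injective (g := fun z => TensorProduct.rid R N.carrier
    ((Coalgebra.counit (R := R) (A := C)).lTensor N.carrier z)) fun n => (h n).choose_spec.2

lemma rightComodToMod_rationalComod (hα : AlphaCondition (toPairing κ)) (N : NUMod R A)
    (h : ∀ n, IsRational κ N n) : (rightComodToMod κ).obj (rationalComod hα N h) = N :=
  NUMod.ext_act fun a n => (rightComodToMod_act κ (rationalComod hα N h) a n).trans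
    (alphaMap_rationalCoact hα N h n a)

end Rational

/-! ### Cofree comodules M ⊗ C -/

section Cofree

-- Applying ε to the middle leg undoes the cofree coaction. This makes the coaction injective and
-- makes a colinear map into M ⊗ C recoverable from its composite with id ⊗ ε.
variable (C) in
lemma rTensor_rid_counit_assoc_symm_comul {M : Type u} [AddCommGroup M] [Module R M]
    (w : M ⊗[R] C) :
    ((TensorProduct.rid R M).toLinearMap ∘ₗ
      (Coalgebra.counit (R := R) (A := C)).lTensor M).rTensor C
        ((TensorProduct.assoc R M C C).symm (Coalgebra.comul.lTensor M w)) = w := by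
  induction w with
  | zero => simp
  | add x y hx hy => simp only [map_add, hx, hy]
  | tmul m c =>
    have key : ∀ y : C ⊗[R] C, ((TensorProduct.rid R M).toLinearMap ∘ₗ
        (Coalgebra.counit (R := R) (A := C)).lTensor M).rTensor C
          ((TensorProduct.assoc R M C C).symm (m ⊗ₜ y)) =
        m ⊗ₜ TensorProduct.lid R C ((Coalgebra.counit (R := R) (A := C)).rTensor C y) := by
      intro y
      induction y with
      | zero => simp
      | add x y hx hy => simp only [TensorProduct.tmul_add, map_add, hx, hy]
      | tmul c d => simp [TensorProduct.smul_tmul]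
    rw [LinearMap.lTensor_tmul, key]
    simp

variable (C) in
/-- The cofree comodule `M ⊗ C`. -/
noncomputable def RightComod.cofree (M : Type u) [AddCommGroup M] [Module R M] :
    RightComod R C where
  carrier := ModuleCat.of R (M ⊗[R] C)
  coact := (TensorProduct.assoc R M C C).symm.toLinearMap ∘ₗ Coalgebra.comul.lTensor M
  coassoc := by
    refine TensorProduct.ext' fun m c => ?_
    simp only [LinearMap.comp_apply, LinearEquiv.coe_coe, LinearMap.lTensor_tmul]
    have h₁ : ∀ y : C ⊗[R] C, TensorProduct.assoc R (M ⊗[R] C) C C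
        (((TensorProduct.assoc R M C C).symm.toLinearMap ∘ₗ Coalgebra.comul.lTensor M).rTensor C
          ((TensorProduct.assoc R M C C).symm (m ⊗ₜ y))) =
        (TensorProduct.assoc R M C (C ⊗[R] C)).symm
          (m ⊗ₜ TensorProduct.assoc R C C C (Coalgebra.comul.rTensor C y)) := by
      intro y
      induction y with
      | zero => simp
      | add x y hx hy => simp only [TensorProduct.tmul_add, map_add, hx, hy]
      | tmul c d =>
        simp only [TensorProduct.assoc_symm_tmul, LinearMap.rTensor_tmul, LinearMap.comp_apply,
          LinearEquiv.coe_coe, LinearMap.lTensor_tmul]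
        generalize Coalgebra.comul (R := R) c = z
        induction z with
        | zero => simp
        | add x y hx hy =>
          simp only [TensorProduct.tmul_add, TensorProduct.add_tmul, map_add, hx, hy]
        | tmul c c' => simp
    have h₂ : ∀ y : C ⊗[R] C, Coalgebra.comul.lTensor (M ⊗[R] C)
          ((TensorProduct.assoc R M C C).symm (m ⊗ₜ y)) =
        (TensorProduct.assoc R M C (C ⊗[R] C)).symm
          (m ⊗ₜ Coalgebra.comul.lTensor C y) := by
      intro y
      induction y with
      | zero => simp
      | add x y hx hy => simp only [TensorProduct.tmul_add, map_add, hx, hy]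
      | tmul c d => simp
    exact (h₁ _).trans (((congrArg _ (congrArg _ (Coalgebra.coassoc_apply c)))).trans
      (h₂ _).symm)
  counital := Function.LeftInverse.injective (rTensor_rid_counit_assoc_symm_comul C)

variable (κ : A →ₙₐ[R] DualAlg R C) (M : Type u) [AddCommGroup M] [Module R M]

lemma cofree_act_tmul (a : A) (m : M) (c : C) :
    ((rightComodToMod κ).obj (RightComod.cofree C M)).act a (m ⊗ₜ[R] c) =
      m ⊗ₜ[R] (show C from (leftMod κ).act a c) := by
  have key : ∀ y : C ⊗[R] C, alphaMap (toPairing κ) (M ⊗[R] C)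
      ((TensorProduct.assoc R M C C).symm (m ⊗ₜ y)) a =
        m ⊗ₜ alphaMap (toPairing κ) C y a := by
    intro y
    induction y with
    | zero => simp
    | add x y hx hy => simp only [TensorProduct.tmul_add, map_add, LinearMap.add_apply, hx, hy]
    | tmul c d => simp
  refine (rightComodToMod_act κ _ a _).trans ((key (Coalgebra.comul c)).trans ?_)
  exact congrArg _ (rightComodToMod_act κ (RightComod.self R C) a c).symm

/-- This is what makes ker α_M stable under A. -/
lemma alphaMap_cofree_act (a b : A) (w : M ⊗[R] C) :
    alphaMap (toPairing κ) M
      (show M ⊗[R] C from ((rightComodToMod κ).obj (RightComod.cofree C M)).act a w) b =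
      alphaMap (toPairing κ) M w (b * a) := by
  rw [← alphaMap_alphaMap_comul]
  exact congrArg (fun z : M ⊗[R] C => alphaMap (toPairing κ) M z b)
    (rightComodToMod_act κ (RightComod.cofree C M) a w)

/-- Consequently id ⊗ ε vanishes on every product ak with k in ker α_M. -/
lemma rid_counit_cofree_act (a : A) (w : M ⊗[R] C) :
    TensorProduct.rid R M ((Coalgebra.counit (R := R) (A := C)).lTensor M
      (show M ⊗[R] C from ((rightComodToMod κ).obj (RightComod.cofree C M)).act a w)) =
      alphaMap (toPairing κ) M w a := by
  refine (congrArg (fun z : M ⊗[R] C => TensorProduct.rid R M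
    ((Coalgebra.counit (R := R) (A := C)).lTensor M z))
    (rightComodToMod_act κ (RightComod.cofree C M) a w)).trans ?_
  refine (alphaMap_rTensor (toPairing κ) ((TensorProduct.rid R M).toLinearMap ∘ₗ
      (Coalgebra.counit (R := R) (A := C)).lTensor M) _ a).symm.trans ?_
  exact congrArg (fun z => alphaMap (toPairing κ) M z a)
    (rTensor_rid_counit_assoc_symm_comul C w)

lemma cofree_isGenerated :
    NUMod.IsGenerated (leftMod κ) ((rightComodToMod κ).obj (RightComod.cofree C M)) := by
  -- One copy of `C` for each element m of `M`, mapped by c ↦ m ⊗ c.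
  let p : (M →₀ C) →ₗ[R] M ⊗[R] C := Finsupp.lsum R fun m => TensorProduct.mk R M C m
  refine ⟨M, (⟨p, fun a x => ?_⟩ : NUMod.Hom _ _), fun w => ?_⟩
  · induction x using Finsupp.induction_linear with
    | zero =>
      exact (map_zero (p ∘ₗ (NUMod.copower M (leftMod κ)).act a)).trans
        (map_zero (((rightComodToMod κ).obj (RightComod.cofree C M)).act a ∘ₗ p)).symm
    | add x y hx hy =>
      exact (map_add (p ∘ₗ (NUMod.copower M (leftMod κ)).act a) x y).trans
        ((congrArg₂ _ hx hy).trans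
        (map_add (((rightComodToMod κ).obj (RightComod.cofree C M)).act a ∘ₗ p) x y).symm)
    | single m c =>
      have h₁ : p (Finsupp.single m c) = m ⊗ₜ[R] (show C from c) :=
        Finsupp.sum_single_index (map_zero _)
      have h₂ : (NUMod.copower M (leftMod κ)).act a (Finsupp.single m c) =
          Finsupp.single m ((leftMod κ).act a c) :=
        Finsupp.mapRange_single (hf := map_zero _)
      rw [h₂]
      refine Eq.trans ?_ ((cofree_act_tmul κ M a m c).symm.trans (congrArg _ h₁.symm))
      exact Finsupp.sum_single_index (map_zero _)
  · change ∃ x, p x = w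
    induction w using TensorProduct.induction_on with
    | zero => exact ⟨0, map_zero _⟩
    | add x y hx hy =>
      obtain ⟨x, rfl⟩ := hx
      obtain ⟨y, rfl⟩ := hy
      exact ⟨x + y, map_add _ _ _⟩
    | tmul m c => exact ⟨Finsupp.single m c, by simp [p]⟩

/-- Comodules are subgenerated by `C`. -/
lemma rightComodToMod_isSubgenerated (N : RightComod R C) :
    NUMod.IsSubgenerated (leftMod κ) ((rightComodToMod κ).obj N) := by
  -- By coassociativity the coaction is itself a colinear embedding into a cofree comodule.
  refine ⟨_, cofree_isGenerated κ N.carrier, (rightComodToMod κ).map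
    (⟨N.coact, LinearMap.ext fun n => ?_⟩ :
      RightComod.Hom N (RightComod.cofree C N.carrier)), N.counital⟩
  exact (LinearEquiv.symm_apply_eq (TensorProduct.assoc R N.carrier C C)).2
    (LinearMap.congr_fun N.coassoc n).symm

end Cofree

end MeasuringPairing

namespace MeasuringPairing

variable {R A D C : Type u} [CommRing R] [NonUnitalRing A] [Module R A]
  [NonUnitalRing D] [Module R D] [AddCommGroup C] [Module R C] [Coalgebra R C]

/-! ### Submodules, quotients and unital modules -/

namespace NUMod

/-- The submodule of `N` on a stable `R`-submodule. -/
def sub (N : NUMod R A) (K : Submodule R N.carrier) (hK : ∀ a, ∀ k ∈ K, N.act a k ∈ K) :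
    NUMod R A where
  carrier := ModuleCat.of R K
  act :=
    { toFun := fun a => (N.act a).restrict (hK a)
      map_smul' := fun r a => LinearMap.ext fun k => Subtype.ext (by simp)
      map_zero' := LinearMap.ext fun k => Subtype.ext (by simp)
      map_add' := fun a b => LinearMap.ext fun k => Subtype.ext (by simp)
      map_mul' := fun a b => LinearMap.ext fun k => Subtype.ext (by simp) }

/-- The inclusion of a submodule. -/
def subι (N : NUMod R A) (K : Submodule R N.carrier) (hK : ∀ a, ∀ k ∈ K, N.act a k ∈ K) :
    N.sub K hK ⟶ N :=
  (⟨K.subtype, fun _ _ => rfl⟩ : Hom (N.sub K hK) N)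

/-- The quotient of `N` by a stable `R`-submodule. -/
def quot (N : NUMod R A) (K : Submodule R N.carrier) (hK : ∀ a, ∀ k ∈ K, N.act a k ∈ K) :
    NUMod R A where
  carrier := ModuleCat.of R (N.carrier ⧸ K)
  act :=
    { toFun := fun a => K.mapQ K (N.act a) (hK a)
      map_smul' := fun r a => Submodule.linearMap_qext _ (LinearMap.ext fun k => by simp)
      map_zero' := Submodule.linearMap_qext _ (LinearMap.ext fun k => by simp)
      map_add' := fun a b => Submodule.linearMap_qext _ (LinearMap.ext fun k => by simp)
      map_mul' := fun a b => Submodule.linearMap_qext _ (LinearMap.ext fun k => by simp) }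

/-- The projection to a quotient. -/
def quotπ (N : NUMod R A) (K : Submodule R N.carrier) (hK : ∀ a, ∀ k ∈ K, N.act a k ∈ K) :
    N ⟶ N.quot K hK :=
  (⟨K.mkQ, fun _ _ => rfl⟩ : Hom N (N.quot K hK))

lemma bijective_lin {M N : NUMod R A} (f : M ⟶ N) [IsIso f] : Function.Bijective f.lin := by
  refine Function.bijective_iff_has_inverse.2 ⟨(inv f).lin, fun m => ?_, fun n => ?_⟩
  · exact LinearMap.congr_fun (congrArg Hom.lin (IsIso.hom_inv_id f)) m
  · exact LinearMap.congr_fun (congrArg Hom.lin (IsIso.inv_hom_id f)) n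

lemma IsGenerated.isSubgenerated {K N : NUMod R A} (h : IsGenerated K N) : IsSubgenerated K N :=
  ⟨N, h, 𝟙 N, fun _ _ h => h⟩

lemma IsGenerated.of_surjective {K N L : NUMod R A} (h : IsGenerated K N) (f : N ⟶ L)
    (hf : Function.Surjective f.lin) : IsGenerated K L := by
  obtain ⟨Λ, p, hp⟩ := h
  exact ⟨Λ, p ≫ f, hf.comp hp⟩

lemma IsUnital.of_surjective {N L : NUMod R A} (h : N.IsUnital) (f : N ⟶ L)
    (hf : Function.Surjective f.lin) : L.IsUnital := by
  refine top_unique ?_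
  rw [← LinearMap.range_eq_top.2 hf, LinearMap.range_eq_map, ← h, Submodule.map_span]
  refine Submodule.span_mono ?_
  rintro _ ⟨_, ⟨a, n, rfl⟩, rfl⟩
  exact ⟨a, f.lin n, (f.map_act a n).symm⟩

/-- A linear map out of a unital module vanishes if it kills all products. -/
lemma IsUnital.eq_zero {N : NUMod R A} (h : N.IsUnital) {M : Type u} [AddCommGroup M]
    [Module R M] (f : N.carrier →ₗ[R] M) (hf : ∀ a n, f (N.act a n) = 0) : f = 0 := by
  refine LinearMap.ext_on h ?_
  rintro _ ⟨a, n, rfl⟩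
  simp [hf]

lemma IsUnital.of_act_eq {N : NUMod R A} (h : ∀ n, ∃ a, N.act a n = n) : N.IsUnital :=
  top_unique fun n _ => Submodule.subset_span ((h n).imp fun _ ha => ⟨n, ha⟩)

end NUMod

/-! ### From the α-condition to σ-categories -/

section AlphaToSigma

variable {κ : A →ₙₐ[R] DualAlg R C}

/-- Modulo the submodule Am the coaction of m is killed by α, hence zero; applying ε shows that m
itself lies in Am. -/
lemma exists_act_eq_of_alphaCondition (hα : AlphaCondition (toPairing κ)) (M : RightComod R C)
    (m : M.carrier) : ∃ a, ((rightComodToMod κ).obj M).act a m = m := by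
  let ev : A →ₗ[R] M.carrier := alphaMap (toPairing κ) M.carrier (M.coact m)
  let q := (LinearMap.range ev).mkQ
  have hq : q.rTensor C (M.coact m) = 0 := by
    refine (injective_iff_map_eq_zero _).1 (hα _) _ (LinearMap.ext fun a => ?_)
    rw [alphaMap_rTensor, LinearMap.zero_apply, Submodule.mkQ_apply,
      Submodule.Quotient.mk_eq_zero]
    exact ⟨a, rfl⟩
  have hm : q m = 0 := by
    conv_lhs => rw [← M.rid_counit_coact m]
    rw [← rid_lTensor_rTensor, hq, map_zero, map_zero]
  obtain ⟨a, ha⟩ := (Submodule.Quotient.mk_eq_zero _).1 hm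
  exact ⟨a, (rightComodToMod_act κ M a m).trans ha⟩

lemma rightComodToMod_obj_injective (hα : AlphaCondition (toPairing κ)) :
    Function.Injective (rightComodToMod κ).obj := by
  rintro ⟨V, ρ, hρ, hρ'⟩ ⟨W, σ, hσ, hσ'⟩ h
  obtain rfl : V = W := congrArg NUMod.carrier h
  have hact := eq_of_heq (NUMod.mk.inj h).2
  have : ρ = σ := LinearMap.ext fun m => hα _ (LinearMap.ext fun a => by
    have h₁ := rightComodToMod_act κ ⟨V, ρ, hρ, hρ'⟩ a m
    have h₂ := rightComodToMod_act κ ⟨V, σ, hσ, hσ'⟩ a m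
    rw [← h₁, ← h₂]
    exact LinearMap.congr_fun (DFunLike.congr_fun hact a) m)
  subst this
  rfl

lemma AlphaCondition.isIsoOntoFull (hα : AlphaCondition (toPairing κ)) :
    IsIsoOntoFull (rightComodToMod κ) (leftMod κ).sigma := by
  refine (isIsoOntoFull_iff _ _).2 ⟨fun M => ⟨?_, rightComodToMod_isSubgenerated κ M⟩,
    ⟨fun {M N} f => ?_⟩, ⟨fun {M N f g} hfg => ?_⟩, rightComodToMod_obj_injective hα,
    fun N hN => ?_⟩
  · exact NUMod.IsUnital.of_act_eq (exists_act_eq_of_alphaCondition hα M)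
  · let φ : M.carrier →ₗ[R] N.carrier := f.lin
    refine ⟨(⟨φ, LinearMap.ext fun m => hα _ (LinearMap.ext fun a => ?_)⟩ :
      RightComod.Hom M N), rfl⟩
    simp only [LinearMap.comp_apply]
    rw [alphaMap_rTensor, ← rightComodToMod_act, ← rightComodToMod_act]
    exact (f.map_act a m).symm
  · have h : f.lin = g.lin := congrArg NUMod.Hom.lin hfg
    exact RightComod.Hom.ext h
  · exact ⟨_, rightComodToMod_rationalComod hα N (IsRational.of_isSubgenerated hα hN.2)⟩

end AlphaToSigma

/-! ### From σ-categories to the α-condition -/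

section SigmaToAlpha

lemma act_eq_self_of_counit {lam : D →ₙₐ[R] DualAlg R C} {e : D}
    (he : (lam e).ofConv = Coalgebra.counit) (M : RightComod R C) (m : M.carrier) :
    ((rightComodToMod lam).obj M).act e m = m := by
  change rightEnd M (lam e).ofConv m = m
  rw [he]
  exact M.rid_counit_coact m

/-- Stated for any D with an element over ε, so that it covers both C^* and, for left comodules, its
opposite algebra. -/
lemma alphaCondition_of_isIsoOntoFull (lam : D →ₙₐ[R] DualAlg R C) (τ : A →ₙₐ[R] D) {e : D}
    (he : (lam e).ofConv = Coalgebra.counit)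
    (h₁ : IsIsoOntoFull (rightComodToMod (lam.comp τ)) (leftMod (lam.comp τ)).sigma)
    (h₂ : IsIsoOntoFull ((leftMod lam).sigma.ι ⋙ NUMod.restrict τ)
      (leftMod (lam.comp τ)).sigma) :
    AlphaCondition (toPairing (lam.comp τ)) := by
  intro M _ _
  rw [isIsoOntoFull_iff] at h₁ h₂
  obtain ⟨hF, _, -, -, hFs⟩ := h₁
  obtain ⟨hG, _, -, -, hGs⟩ := h₂
  let κ := lam.comp τ
  let X : RightComod R C := RightComod.cofree C M
  let N := (rightComodToMod κ).obj X
  let N' := (rightComodToMod lam).obj X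
  let K : Submodule R (M ⊗[R] C) := LinearMap.ker (alphaMap (toPairing κ) M)
  have hK : ∀ a, ∀ k ∈ K, N.act a k ∈ K := fun a k hk => LinearMap.ext fun b => by
    rw [LinearMap.mem_ker] at hk
    refine (alphaMap_cofree_act κ M a b k).trans ?_
    rw [hk]
    rfl
  have hN' : (leftMod lam).sigma N' :=
    ⟨NUMod.IsUnital.of_act_eq fun n => ⟨e, act_eq_self_of_counit he X n⟩,
      (cofree_isGenerated lam M).isSubgenerated⟩
  -- Surjectivity on objects extends the A-action on the quotient by `K` to `D`; fullness then makes
  -- the projection `D`-linear, so its kernel `K` is `D`-stable.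
  obtain ⟨Q, hQ⟩ := hGs (N.quot K hK)
    ⟨(hF X).1.of_surjective (N.quotπ K hK) (Submodule.mkQ_surjective _),
      ((cofree_isGenerated κ M).of_surjective (N.quotπ K hK)
        (Submodule.mkQ_surjective _)).isSubgenerated⟩
  let f : N ⟶ ((leftMod lam).sigma.ι ⋙ NUMod.restrict τ).obj Q :=
    N.quotπ K hK ≫ eqToHom hQ.symm
  let X' : (leftMod lam).sigma.FullSubcategory := ⟨N', hN'⟩
  obtain ⟨g, hg⟩ := ((leftMod lam).sigma.ι ⋙ NUMod.restrict τ).map_surjective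
    (X := X') (Y := Q) f
  have hgf : g.hom.lin = f.lin := congrArg NUMod.Hom.lin hg
  have hker : ∀ n : M ⊗[R] C, n ∈ K ↔ g.hom.lin n = 0 := fun n => by
    have hinj := (NUMod.bijective_lin (eqToHom hQ.symm)).1
    have h : g.hom.lin n = (eqToHom hQ.symm).lin (K.mkQ n) := LinearMap.congr_fun hgf n
    rw [← Submodule.ker_mkQ K, LinearMap.mem_ker]
    exact ⟨fun h0 => h.trans ((congrArg _ h0).trans (map_zero _)),
      fun h0 => hinj ((h.symm.trans h0).trans (map_zero _).symm)⟩
  have hKD : ∀ d, ∀ k ∈ K, N'.act d k ∈ K := fun d k hk => by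
    refine (hker _).2 ((g.hom.map_act d k).trans ?_)
    exact (congrArg _ ((hker k).1 hk)).trans (map_zero _)
  let K' := N'.sub K hKD
  have hK' : (leftMod lam).sigma K' :=
    ⟨NUMod.IsUnital.of_act_eq fun k => ⟨e, Subtype.ext (act_eq_self_of_counit he X k.1)⟩,
      N', cofree_isGenerated lam M, N'.subι K hKD, Subtype.val_injective⟩
  -- Back over `A`, `K` is now known to be unital, and it carries a coaction for which fullness
  -- makes the inclusion colinear.
  have hKσ := hG ⟨K', hK'⟩
  obtain ⟨Y, hY⟩ := hFs _ hKσ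
  let i : (NUMod.restrict τ).obj K' ⟶ N := (NUMod.restrict τ).map (N'.subι K hKD)
  let iso : (rightComodToMod κ).obj Y ⟶ (NUMod.restrict τ).obj K' := eqToHom hY
  obtain ⟨j, hj⟩ := (rightComodToMod κ).map_surjective (iso ≫ i)
  have hji : ∀ y, j.lin y = i.lin (iso.lin y) := fun y =>
    LinearMap.congr_fun (congrArg NUMod.Hom.lin hj) y
  let θ : M ⊗[R] C →ₗ[R] M := (TensorProduct.rid R M).toLinearMap ∘ₗ
    (Coalgebra.counit (R := R) (A := C)).lTensor M
  have hθ : θ ∘ₗ i.lin = 0 := hKσ.1.eq_zero _ fun a k => by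
    refine (rid_counit_cofree_act κ M a k.1).trans ?_
    have hk : alphaMap (toPairing κ) M k.1 = 0 := k.2
    rw [hk]
    rfl
  have hθj : θ ∘ₗ j.lin = 0 := LinearMap.ext fun y =>
    (congrArg θ (hji y)).trans (LinearMap.congr_fun hθ (iso.lin y))
  -- By colinearity, `j` is (θj ⊗ id) composed with the coaction of `Y`.
  have hj0 : ∀ y, j.lin y = 0 := fun y => by
    have h := congrArg (θ.rTensor C) (LinearMap.congr_fun j.colinear y)
    refine ((rTensor_rid_counit_assoc_symm_comul C (j.lin y)).symm.trans h).trans ?_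
    refine (LinearMap.congr_fun (LinearMap.rTensor_comp C θ j.lin) (Y.coact y)).symm.trans ?_
    rw [hθj, LinearMap.rTensor_zero, LinearMap.zero_apply]
    rfl
  refine (injective_iff_map_eq_zero _).2 fun z hz => ?_
  obtain ⟨y, hy⟩ := (NUMod.bijective_lin iso).2 ⟨z, hz⟩
  have := (hji y).symm.trans (hj0 y)
  rw [hy] at this
  exact this

end SigmaToAlpha

/-- The `α`-condition for `lam ∘ τ` in terms of isomorphisms onto categories of subgenerated
modules, where the counit lies in the image of `lam`. -/
lemma alphaCondition_comp_iff (lam : D →ₙₐ[R] DualAlg R C) (τ : A →ₙₐ[R] D) {e : D}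
    (he : (lam e).ofConv = Coalgebra.counit) :
    AlphaCondition (toPairing (lam.comp τ)) ↔
      IsIsoOntoFull (rightComodToMod (lam.comp τ)) (leftMod (lam.comp τ)).sigma ∧
      IsIsoOntoFull ((leftMod lam).sigma.ι ⋙ NUMod.restrict τ)
        (leftMod (lam.comp τ)).sigma := by
  refine ⟨fun h => ⟨h.isIsoOntoFull, ?_⟩,
    fun h => alphaCondition_of_isIsoOntoFull lam τ he h.1 h.2⟩
  have hlam : AlphaCondition (toPairing lam) := h.of_range_subset (by
    rintro _ ⟨a, rfl⟩
    exact ⟨τ a, rfl⟩)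
  exact IsIsoOntoFull.of_comp hlam.isIsoOntoFull h.isIsoOntoFull

end MeasuringPairing

namespace MeasuringPairing

/-! ### Left comodules via the co-opposite coalgebra -/

section Coopposite

/-- The co-opposite of a coalgebra. -/
def Cop (C : Type u) : Type u := C

variable {R A C : Type u} [CommRing R] [NonUnitalRing A] [Module R A]
  [AddCommGroup C] [Module R C]

instance : AddCommGroup (Cop C) := inferInstanceAs (AddCommGroup C)

instance : Module R (Cop C) := inferInstanceAs (Module R C)

/-- Reversal of a threefold tensor product. -/
noncomputable def tensorReverse (M N P : Type u) [AddCommGroup M] [Module R M] [AddCommGroup N]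
    [Module R N] [AddCommGroup P] [Module R P] :
    M ⊗[R] (N ⊗[R] P) ≃ₗ[R] P ⊗[R] (N ⊗[R] M) :=
  (TensorProduct.comm R M (N ⊗[R] P)).trans
    ((TensorProduct.congr (TensorProduct.comm R N P) (LinearEquiv.refl R M)).trans
      (TensorProduct.assoc R P N M))

@[simp]
lemma tensorReverse_tmul {M N P : Type u} [AddCommGroup M] [Module R M] [AddCommGroup N]
    [Module R N] [AddCommGroup P] [Module R P] (m : M) (n : N) (p : P) :
    tensorReverse (R := R) M N P (m ⊗ₜ (n ⊗ₜ p)) = p ⊗ₜ (n ⊗ₜ m) := rfl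

lemma assoc_rTensor_comm {M : Type u} [AddCommGroup M] [Module R M] (ρ : M →ₗ[R] C ⊗[R] M)
    (y : C ⊗[R] M) :
    TensorProduct.assoc R M C C
      (((TensorProduct.comm R C M).toLinearMap ∘ₗ ρ).rTensor C (TensorProduct.comm R C M y)) =
    tensorReverse C C M (ρ.lTensor C y) := by
  induction y with
  | zero => simp
  | add x y hx hy => simp only [map_add, hx, hy]
  | tmul c m =>
    simp only [TensorProduct.comm_tmul, LinearMap.rTensor_tmul, LinearMap.lTensor_tmul,
      LinearMap.comp_apply, LinearEquiv.coe_coe]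
    generalize ρ m = z
    induction z with
    | zero => simp
    | add x y hx hy => simp only [TensorProduct.tmul_add, TensorProduct.add_tmul, map_add, hx, hy]
    | tmul d m => simp

lemma lTensor_comm_comp {M : Type u} [AddCommGroup M] [Module R M] (Δ : C →ₗ[R] C ⊗[R] C)
    (y : C ⊗[R] M) :
    ((TensorProduct.comm R C C).toLinearMap ∘ₗ Δ).lTensor M (TensorProduct.comm R C M y) =
    tensorReverse C C M (TensorProduct.assoc R C C M (Δ.rTensor M y)) := by
  induction y with
  | zero => simp
  | add x y hx hy => simp only [map_add, hx, hy]
  | tmul c m =>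
    simp only [TensorProduct.comm_tmul, LinearMap.rTensor_tmul, LinearMap.lTensor_tmul,
      LinearMap.comp_apply, LinearEquiv.coe_coe]
    generalize Δ c = z
    induction z with
    | zero => simp
    | add x y hx hy => simp only [TensorProduct.tmul_add, TensorProduct.add_tmul, map_add, hx, hy]
    | tmul d m => simp

/-- The bijection `tensorReverse` carries each side of the left coassociativity law to one side of
the right law. -/
lemma comm_coassoc_iff {M : Type u} [AddCommGroup M] [Module R M] (Δ : C →ₗ[R] C ⊗[R] C)
    (ρ : M →ₗ[R] C ⊗[R] M) :
    ((TensorProduct.assoc R M C C).toLinearMap ∘ₗ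
        ((TensorProduct.comm R C M).toLinearMap ∘ₗ ρ).rTensor C ∘ₗ
          ((TensorProduct.comm R C M).toLinearMap ∘ₗ ρ) =
      ((TensorProduct.comm R C C).toLinearMap ∘ₗ Δ).lTensor M ∘ₗ
        ((TensorProduct.comm R C M).toLinearMap ∘ₗ ρ)) ↔
    ((TensorProduct.assoc R C C M).toLinearMap ∘ₗ Δ.rTensor M ∘ₗ ρ = ρ.lTensor C ∘ₗ ρ) := by
  simp only [LinearMap.ext_iff, LinearMap.comp_apply, LinearEquiv.coe_coe]
  refine forall_congr' fun m => ?_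
  have h₁ := assoc_rTensor_comm ρ (ρ m)
  have h₂ := lTensor_comm_comp Δ (ρ m)
  rw [h₁, h₂, EmbeddingLike.apply_eq_iff_eq]
  exact eq_comm

variable [Coalgebra R C]

noncomputable instance : Coalgebra R (Cop C) where
  comul := (TensorProduct.comm R C C).toLinearMap ∘ₗ Coalgebra.comul (R := R) (A := C)
  counit := Coalgebra.counit (R := R) (A := C)
  coassoc := (comm_coassoc_iff (M := C) (Coalgebra.comul (R := R) (A := C))
    (Coalgebra.comul (R := R) (A := C))).2
    (Coalgebra.coassoc (R := R) (A := C))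
  rTensor_counit_comp_comul := by
    refine LinearMap.ext fun c => ?_
    refine (LinearMap.rTensor_comm (Coalgebra.counit (R := R) (A := C))
      (Coalgebra.comul (R := R) (A := C) c)).trans ?_
    exact congrArg (TensorProduct.comm R C R) (Coalgebra.lTensor_counit_comul (A := C) c)
  lTensor_counit_comp_comul := by
    refine LinearMap.ext fun c => ?_
    refine (LinearMap.lTensor_comm (Coalgebra.counit (R := R) (A := C))
      (Coalgebra.comul (R := R) (A := C) c)).trans ?_
    exact congrArg (TensorProduct.comm R R C) (Coalgebra.rTensor_counit_comul (A := C) c)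

/-- Left `C`-comodules as right comodules over the co-opposite. -/
noncomputable def leftToRight : LeftComod R C ⥤ RightComod R (Cop C) where
  obj M :=
    { carrier := M.carrier
      coact := (TensorProduct.comm R C M.carrier).toLinearMap ∘ₗ M.coact
      coassoc := (comm_coassoc_iff (Coalgebra.comul (R := R) (A := C)) M.coact).2 M.coassoc
      counital := (TensorProduct.comm R C M.carrier).injective.comp M.counital }
  map {M N} f := (⟨f.lin, LinearMap.ext fun m => by
    refine (congrArg (TensorProduct.comm R C N.carrier)
      (LinearMap.congr_fun f.colinear m)).trans ?_
    exact (LinearMap.rTensor_comm f.lin (M.coact m)).symm⟩ : RightComod.Hom _ _)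

instance : (leftToRight (R := R) (C := C)).Faithful where
  map_injective h := LeftComod.Hom.ext (congrArg RightComod.Hom.lin h)

instance : (leftToRight (R := R) (C := C)).Full where
  map_surjective {M N} f := by
    let φ : M.carrier →ₗ[R] N.carrier := f.lin
    refine ⟨(⟨φ, LinearMap.ext fun m => (TensorProduct.comm R C N.carrier).injective ?_⟩ :
      LeftComod.Hom M N), rfl⟩
    refine (LinearMap.congr_fun f.colinear m).trans ?_
    exact LinearMap.rTensor_comm φ (M.coact m)

lemma leftToRight_obj_bijective :
    Function.Bijective (leftToRight (R := R) (C := C)).obj := by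
  refine ⟨?_, fun N => ?_⟩
  · rintro ⟨V, ρ, hρ, hρ'⟩ ⟨W, σ, hσ, hσ'⟩ h
    obtain rfl : V = W := congrArg RightComod.carrier h
    have h' : (TensorProduct.comm R C V).toLinearMap ∘ₗ ρ =
      (TensorProduct.comm R C V).toLinearMap ∘ₗ σ := eq_of_heq (RightComod.mk.inj h).2
    obtain rfl : ρ = σ := LinearMap.ext fun m =>
      (TensorProduct.comm R C V).injective (LinearMap.congr_fun h' m)
    rfl
  · obtain ⟨V, ρ, hρ, hρ'⟩ := N
    obtain ⟨σ, rfl⟩ : ∃ σ : V →ₗ[R] C ⊗[R] V, ρ = (TensorProduct.comm R C V).toLinearMap ∘ₗ σ :=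
      ⟨(TensorProduct.comm R C V).symm.toLinearMap ∘ₗ ρ,
        LinearMap.ext fun m => ((TensorProduct.comm R C V).apply_symm_apply (ρ m)).symm⟩
    exact ⟨⟨V, σ, (comm_coassoc_iff (Coalgebra.comul (R := R) (A := C)) σ).1 hρ,
      Function.Injective.of_comp hρ'⟩, rfl⟩

variable (R C) in
/-- The opposite of the dual algebra is the dual algebra of the co-opposite. -/
def opDual : (DualAlg R C)ᵐᵒᵖ →ₙₐ[R] DualAlg R (Cop C) where
  toFun f := WithConv.toConv (show C →ₗ[R] R from f.unop.ofConv)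
  map_smul' _ _ := rfl
  map_zero' := rfl
  map_add' _ _ := rfl
  map_mul' f g := by
    refine WithConv.ofConv_injective (LinearMap.ext fun c => ?_)
    change LinearMap.mul' R R (TensorProduct.map g.unop.ofConv f.unop.ofConv
      (Coalgebra.comul (R := R) (A := C) c)) = LinearMap.mul' R R
        (TensorProduct.map f.unop.ofConv g.unop.ofConv
          (TensorProduct.comm R C C (Coalgebra.comul (R := R) (A := C) c)))
    generalize Coalgebra.comul (R := R) (A := C) c = z
    induction z with
    | zero => simp
    | add x y hx hy => simp only [map_add, hx, hy]
    | tmul c d => simp [mul_comm]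

/-- The pairing of `Aᵐᵒᵖ` with the co-opposite. -/
noncomputable def opPairing (κ : A →ₙₐ[R] DualAlg R C) : Aᵐᵒᵖ →ₙₐ[R] DualAlg R (Cop C) :=
  (opDual R C).comp (opHom κ)

lemma NUMod.eqToHom_lin {V : ModuleCat.{u} R} {a b : A →ₙₐ[R] Module.End R V}
    (h : (⟨V, a⟩ : NUMod R A) = ⟨V, b⟩) : (eqToHom h).lin = (LinearMap.id : V →ₗ[R] V) := by
  obtain rfl := eq_of_heq (NUMod.mk.inj h).2
  rfl

lemma leftEnd_eq_rightEnd (M : LeftComod R C) (f : C →ₗ[R] R) :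
    leftEnd M f = rightEnd (leftToRight.obj M) f := by
  refine LinearMap.ext fun m => ?_
  change TensorProduct.lid R M.carrier (f.rTensor M.carrier (M.coact m)) =
    TensorProduct.rid R M.carrier (f.lTensor M.carrier
      (TensorProduct.comm R C M.carrier (M.coact m)))
  rw [LinearMap.lTensor_comm]
  simp

lemma leftComodToMod_obj (κ : A →ₙₐ[R] DualAlg R C) (M : LeftComod R C) :
    (leftComodToMod κ).obj M = (rightComodToMod (opPairing κ)).obj (leftToRight.obj M) :=
  (NUMod.ext_act (N := (rightComodToMod (opPairing κ)).obj (leftToRight.obj M))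
    (act := ((leftComodToMod κ).obj M).act)
    fun a n => LinearMap.congr_fun (leftEnd_eq_rightEnd M (κ a.unop).ofConv) n)

/-- Equality of functors is needed: `IsIsoOntoFull` asks for strict inverses and is not invariant
under natural isomorphism. -/
lemma leftComodToMod_eq (κ : A →ₙₐ[R] DualAlg R C) :
    leftComodToMod κ = leftToRight ⋙ rightComodToMod (opPairing κ) := by
  refine CategoryTheory.Functor.ext (leftComodToMod_obj κ) fun M N f => NUMod.Hom.ext ?_
  have h₁ := NUMod.eqToHom_lin (leftComodToMod_obj κ M)
  have h₂ := NUMod.eqToHom_lin (leftComodToMod_obj κ N).symm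
  refine LinearMap.ext fun m => ?_
  refine Eq.trans ?_ (LinearMap.congr_fun h₂ _).symm
  exact (congrArg f.lin (LinearMap.congr_fun h₁ m)).symm

lemma rightMod_eq (κ : A →ₙₐ[R] DualAlg R C) : rightMod κ = leftMod (opPairing κ) :=
  leftComodToMod_obj κ (LeftComod.self R C)

/-- Both pairings have the same set of functionals on the same R-module. -/
lemma alphaCondition_opPairing_iff (κ : A →ₙₐ[R] DualAlg R C) :
    AlphaCondition (toPairing (opPairing κ)) ↔ AlphaCondition (toPairing κ) :=
  ⟨fun h => AlphaCondition.of_range_subset (W := C) h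
      (by rintro _ ⟨a, rfl⟩; exact ⟨a.unop, rfl⟩),
    fun h => AlphaCondition.of_range_subset (W := C) h
      (by rintro _ ⟨a, rfl⟩; exact ⟨MulOpposite.op a, rfl⟩)⟩

lemma alphaCondition_iff_rightComodIsSigma (κ : A →ₙₐ[R] DualAlg R C) :
    AlphaCondition (toPairing κ) ↔ RightComodIsSigma κ :=
  alphaCondition_comp_iff (dualPairing R C) κ (e := WithConv.toConv Coalgebra.counit) rfl

lemma alphaCondition_iff_leftComodIsSigma (κ : A →ₙₐ[R] DualAlg R C) :
    AlphaCondition (toPairing κ) ↔ LeftComodIsSigma κ := by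
  have hdual : rightMod (dualPairing R C) = leftMod (opDual R C) :=
    rightMod_eq (dualPairing R C)
  unfold LeftComodIsSigma
  rw [leftComodToMod_eq, rightMod_eq κ, hdual,
    isIsoOntoFull_comp_iff _ leftToRight_obj_bijective, ← alphaCondition_opPairing_iff]
  exact alphaCondition_comp_iff (opDual R C) (opHom κ)
    (e := MulOpposite.op (WithConv.toConv Coalgebra.counit)) rfl

end Coopposite

end MeasuringPairing

theorem mainTheorem2 {R A C : Type u} [CommRing R] [Nontrivial R]
    [NonUnitalRing A] [Module R A] [IsScalarTower R A A] [SMulCommClass R A A]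
    [AddCommGroup C] [Module R C] [Coalgebra R C]
    (κ : A →ₙₐ[R] MeasuringPairing.DualAlg R C) :
    List.TFAE
      [MeasuringPairing.AlphaCondition (MeasuringPairing.toPairing κ),
       MeasuringPairing.RightComodIsSigma κ,
       MeasuringPairing.LocallyProjective R C ∧
         MeasuringPairing.DenseImage (MeasuringPairing.toPairing κ),
       MeasuringPairing.LeftComodIsSigma κ] := by
  tfae_have 1 ↔ 2 := MeasuringPairing.alphaCondition_iff_rightComodIsSigma κ
  tfae_have 1 ↔ 3 := MeasuringPairing.alphaCondition_iff _
  tfae_have 1 ↔ 4 := MeasuringPairing.alphaCondition_iff_leftComodIsSigma κ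
  tfae_finish
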